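/- An instance of delegated stochastic probing consists of a finite ground set $E$; a probability distribution $\mu_e$ on $\mathbb{R}_{\ge 0}\times\mathbb{R}_{\ge 0}$ for each $e\in E$; and two downwards-closed families $\mathcal{I}_{\mathrm{out}},\mathcal{I}_{\mathrm{in}}\subseteq 2^E$ containing $\emptyset$ (the outer and inner constraints). The pairs $(X_e,Y_e)\sim\mu_e$ of utilities of the principal and the agent are mutually independent over $e\in E$ (while $X_e,Y_e$ may be correlated). An outcome is a triple $(e,x,y)$ with $(x,y)\in\operatorname{supp}\mu_e$; for a set $T$ of outcomes, $x(T)$ and $y(T)$ denote the sums of the $x$- and $y$-components, and for $F\subseteq E$ let $\Omega_F=\{(e,X_e,Y_e):e\in F\}$. An adaptive probing strategy probes elements one at a time, each at most once, observing $(X_e,Y_e)$ upon probing $e$ and deciding (measurably) on the basis of the observations so far whether to stop or which element to probe next, so that the probed set always stays in $\mathcal{I}_{\mathrm{out}}$. The non-delegated value $\mathrm{OPT}\in[0,\infty]$ is the supremum over adaptive probing strategies of $\mathbb{E}\,u(F)$, where $F$ is the random set of probed elements and $u(F)=\max\{x(\Omega_G): G\subseteq F,\ G\in\mathcal{I}_{\mathrm{in}}\}$.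 A deterministic policy is a family $\mathcal{R}$ of (acceptable) sets of outcomes, each with distinct elements forming a set in $\mathcal{I}_{\mathrm{in}}$, such that $\{\Omega_G\in\mathcal{R}\}$ is measurable for every $G\subseteq E$. Under $\mathcal{R}$, an agent who has probed $F$ proposes a set $T\subseteq\Omega_F$ with $T\in\mathcal{R}$ maximizing $y(T)$ (or $T=\emptyset$ if there is no acceptable subset of $\Omega_F$), and principal and agent receive $x(T)$ and $y(T)$. A probing strategy is agent-optimal under $\mathcal{R}$ if it maximizes the agent's resulting expected utility among all adaptive probing strategies. The policy $\mathcal{R}$ is an $\alpha$-policy if there is an agent-optimal adaptive probing strategy such that, however ties among the agent's favorite acceptable proposals are broken (even adversarially), the principal's expected utility is at least $\alpha\cdot\mathrm{OPT}$. **Corollary.** For every instance of delegated stochastic probing in which $\mathcal{I}_{\mathrm{out}}$ is the family of independent sets of a matroid on $E$ and the inner constraint is $1$-uniform (that is, $\mathcal{I}_{\mathrm{in}}=\{G\subseteq E:|G|\le 1\}$), there exists a deterministic $\tfrac12\left(1-\tfrac1e\right)$-policy. -/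

import Mathlib

open MeasureTheory
open scoped NNReal ENNReal

noncomputable section

namespace DelegatedProbing

/-- A downwards-closed set system on the finite ground set `E`. -/
structure SetSystem (E : Type*) where
  feasible : Set (Finset E)
  empty_mem : ∅ ∈ feasible
  down_closed : ∀ ⦃S T : Finset E⦄, S ⊆ T → T ∈ feasible → S ∈ feasible

/-- The feasible sets are exactly the independent sets of a matroid with ground set `E`. -/
def SetSystem.IsMatroid {E : Type*} (C : SetSystem E) : Prop :=
  ∃ M : Matroid E, M.E = Set.univ ∧ ∀ F : Finset E, F ∈ C.feasible ↔ M.Indep (F : Set E)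

/-- The feasible sets are exactly the sets with at most `k` elements. -/
def SetSystem.IsUniform {E : Type*} (C : SetSystem E) (k : ℕ) : Prop :=
  ∀ F : Finset E, F ∈ C.feasible ↔ F.card ≤ k

/-- An instance of delegated stochastic probing: a probability distribution `μ e` on pairs
(principal's utility, agent's utility) of nonnegative reals for each element `e`, an outer
constraint on the probed sets and an inner constraint on the selected sets. -/
structure Instance (E : Type*) where
  μ : E → Measure (ℝ≥0 × ℝ≥0)
  isProb : ∀ e, IsProbabilityMeasure (μ e)
  outer : SetSystem E
  inner : SetSystem E

/-- A state of the world: the pair of utilities `(X_e, Y_e)` of every element. -/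
abbrev State (E : Type*) := E → ℝ≥0 × ℝ≥0

/-- An outcome `(e, x, y)`. -/
abbrev Outcome (E : Type*) := E × ℝ≥0 × ℝ≥0

variable {E : Type*} [Fintype E] [DecidableEq E]

/-- The law of the state: the elements are independent, element `e` having law `μ e`. -/
def Instance.law (I : Instance E) : Measure (State E) :=
  Measure.pi I.μ

/-- The outcomes obtained in state `ω` from the elements of `F`. -/
def outcomes (ω : State E) (F : Finset E) : Finset (Outcome E) :=
  F.image fun e => (e, ω e)

/-- The principal's utility `x(T)` of a set of outcomes. -/
def xUtil (T : Finset (Outcome E)) : ℝ≥0 := ∑ o ∈ T, o.2.1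

/-- The agent's utility `y(T)` of a set of outcomes. -/
def yUtil (T : Finset (Outcome E)) : ℝ≥0 := ∑ o ∈ T, o.2.2

/-- The set `Ω` of all outcomes `(e, x, y)` with `(x, y)` in the support of `μ e`. -/
def Instance.possibleOutcomes (I : Instance E) : Set (Outcome E) :=
  {o | o.2 ∈ (I.μ o.1).support}

/-- The family `Ω_in` of all sets of outcomes whose elements are distinct and feasible for the
inner constraint. -/
def Instance.solutions (I : Instance E) : Set (Finset (Outcome E)) :=
  {T | (T : Set (Outcome E)) ⊆ I.possibleOutcomes ∧
    Set.InjOn Prod.fst (T : Set (Outcome E)) ∧ T.image Prod.fst ∈ I.inner.feasible}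

/-- A deterministic (single-proposal) policy: a family of acceptable sets of outcomes. For each
set of elements, the event that its outcomes are acceptable is required to be measurable. -/
def Instance.IsPolicy (I : Instance E) (R : Set (Finset (Outcome E))) : Prop :=
  R ⊆ I.solutions ∧ ∀ G : Finset E, MeasurableSet {ω : State E | outcomes ω G ∈ R}

/-- An adaptive probing strategy. Given the set `S` of elements probed so far and the utilities
observed on `S` (and on nothing else), it either stops (`none`) or names a new element to probe
so that the probed set stays feasible for the outer constraint. -/
structure Instance.ProbingStrategy (I : Instance E) where
  next : (S : Finset E) → (S → ℝ≥0 × ℝ≥0) → Option E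
  measurable_next : ∀ (S : Finset E) (e : E), MeasurableSet {o | next S o = some e}
  next_feasible : ∀ (S : Finset E) (o : S → ℝ≥0 × ℝ≥0) (e : E), next S o = some e →
    e ∉ S ∧ insert e S ∈ I.outer.feasible

/-- One step of a strategy in state `ω`, from the probed set `S`. -/
def Instance.ProbingStrategy.step {I : Instance E} (σ : I.ProbingStrategy) (ω : State E)
    (S : Finset E) : Finset E :=
  match σ.next S (fun e => ω e) with
  | none => S
  | some e => insert e S

/-- The set of all elements that the strategy probes in state `ω`. Each step adds a new element
or stops for good, so `|E|` steps suffice. -/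
def Instance.ProbingStrategy.probed {I : Instance E} (σ : I.ProbingStrategy) (ω : State E) :
    Finset E :=
  (σ.step ω)^[Fintype.card E] ∅

open Classical in
/-- The non-delegating principal's utility `u(F)` in state `ω` after probing `F`: the maximum of
`x(G)` over all `G ⊆ F` that are feasible for the inner constraint. -/
def Instance.u (I : Instance E) (ω : State E) (F : Finset E) : ℝ≥0 :=
  (F.powerset.filter (· ∈ I.inner.feasible)).sup fun G => xUtil (outcomes ω G)

/-- The expected utility of an optimal adaptive non-delegating principal. -/
def Instance.nonDelegatedValue (I : Instance E) : ℝ≥0∞ :=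
  ⨆ σ : I.ProbingStrategy, ∫⁻ ω, (I.u ω (σ.probed ω) : ℝ≥0∞) ∂I.law

open Classical in
/-- The sets of outcomes which are acceptable under `R` and contained in the obtained set `S`. -/
def acceptable (R : Set (Finset (Outcome E))) (S : Finset (Outcome E)) :
    Finset (Finset (Outcome E)) :=
  S.powerset.filter (· ∈ R)

/-- The agent's expected utility under policy `R` when he probes according to `σ` and then
proposes a best acceptable set (he gets `0` if there is none). -/
def Instance.agentValue (I : Instance E) (R : Set (Finset (Outcome E)))
    (σ : I.ProbingStrategy) : ℝ≥0∞ :=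
  ∫⁻ ω, ((acceptable R (outcomes ω (σ.probed ω))).sup yUtil : ℝ≥0) ∂I.law

/-- `σ` is an optimal adaptive probing strategy of the agent under policy `R`. -/
def Instance.IsAgentOptimal (I : Instance E) (R : Set (Finset (Outcome E)))
    (σ : I.ProbingStrategy) : Prop :=
  ∀ σ' : I.ProbingStrategy, I.agentValue R σ' ≤ I.agentValue R σ

/-- `T` is a favorite proposal of an agent who has obtained the outcomes `S`: an acceptable
subset of `S` that maximizes `y`, or the null proposal `∅` if there is no acceptable subset. -/
def IsFavorite (R : Set (Finset (Outcome E))) (S T : Finset (Outcome E)) : Prop :=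
  (T ∈ acceptable R S ∧ ∀ T' ∈ acceptable R S, yUtil T' ≤ yUtil T) ∨
    (acceptable R S = ∅ ∧ T = ∅)

/-- `R` is an `α`-policy: some optimal adaptive agent guarantees the principal an `α` fraction of
the non-delegated value, however ties among favorite proposals are broken. The tie-breaking
`prop` is arbitrary; the integral below is the lower integral if `prop` is not measurable. -/
def Instance.IsAlphaPolicy (I : Instance E) (α : ℝ) (R : Set (Finset (Outcome E))) : Prop :=
  I.IsPolicy R ∧ ∃ σ : I.ProbingStrategy, I.IsAgentOptimal R σ ∧
    ∀ prop : State E → Finset (Outcome E),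
      (∀ ω, IsFavorite R (outcomes ω (σ.probed ω)) (prop ω)) →
        ENNReal.ofReal α * I.nonDelegatedValue ≤ ∫⁻ ω, (xUtil (prop ω) : ℝ≥0∞) ∂I.law

end DelegatedProbing

end

set_option linter.unusedSectionVars false

/-! Two losses multiply: replacing adaptive probing by a fixed base costs a factor `1 - 1/e`, and
delegating over a fixed set costs a factor `1/2`.

Adaptivity: extend every set that an adaptive strategy may probe to a base, and average the
indicators of these bases with the law of the probed set. The resulting `y` dominates the probing
probabilities. Whether `e` is probed is independent of the utilities of `e`, so a union bound gives
`P(max > t) ≤ min 1 (∑ y e * p t e)`, and `1 - 1/e` times the right side is at most `1 - ∏ (1 - y e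
* p t e)`. Integrated over `t`, the last expression is `coverage`. It is convex along every exchange
direction, so swap rounding (`exists_isBase_merge`, `exists_isBase_coverage_le`) replaces `y` by a
single base without loss.

Delegation: accept only single outcomes, from the fixed set, worth at least `τ` to the principal,
where `2τ` is the expected maximum. Probing the whole set is then optimal for the agent. The
threshold proof of the prophet inequality survives an adversary who sees everything and picks any
acceptable outcome, so the principal still gets `τ` (`half_le_lintegral_xUtil`). An infinite
expected maximum is handled by a single element. -/

theorem Matroid.IsBase.symm_exchange {α : Type*} {M : Matroid α} {B₁ B₂ : Set α} {e : α}
    (hB₁ : M.IsBase B₁) (hB₂ : M.IsBase B₂) (he₁ : e ∈ B₁) (he₂ : e ∉ B₂) :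
    ∃ f ∈ B₂, f ∉ B₁ ∧ M.IsBase (insert f (B₁ \ {e})) ∧ M.IsBase (insert e (B₂ \ {f})) := by
  have heE : e ∈ M.E := hB₁.subset_ground he₁
  have hecl : e ∈ M.closure B₂ := by rwa [hB₂.closure_eq]
  have hC := hB₂.fundCircuit_isCircuit heE he₂
  -- If the rest of the circuit lay in the closure of `B₁ \ {e}`, so would `e`. Any circuit element
  -- `f` outside that closure serves both exchanges.
  have hnot : ¬ (M.fundCircuit e B₂ \ {e} ⊆ M.closure (B₁ \ {e})) := fun h =>
    hB₁.indep.notMem_closure_sdiff_of_mem he₁ <|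
      M.closure_subset_closure_of_subset_closure h
        (hC.mem_closure_sdiff_singleton_of_mem (M.mem_fundCircuit e B₂))
  obtain ⟨f, ⟨hfC, hfe⟩, hf⟩ := Set.not_subset.1 hnot
  have hfe : f ≠ e := hfe
  have hfB₂ : f ∈ B₂ := (M.fundCircuit_subset_insert e B₂ hfC).resolve_left hfe
  have hfE : f ∈ M.E := hB₂.subset_ground hfB₂
  have hfB₁ : f ∉ B₁ := fun h =>
    hf (M.mem_closure_of_mem ⟨h, hfe⟩ (Set.sdiff_subset.trans hB₁.subset_ground))
  refine ⟨f, hfB₂, hfB₁, ?_, ?_⟩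
  · exact hB₁.exchange_base_of_notMem_closure he₁ hf
  · have h := (hB₂.indep.mem_fundCircuit_iff hecl he₂).1 hfC
    have h' := hB₂.exchange_isBase_of_indep' hfB₂ he₂ h
    rwa [← Set.insert_sdiff_singleton_comm hfe.symm] at h'

noncomputable section

namespace DelegatedProbing

/-- The indicator vector of a finite set. -/
def indicatorVec {E : Type*} [DecidableEq E] (B : Finset E) (e : E) : ℝ := if e ∈ B then 1 else 0

/-- The probability that some selected element succeeds, integrated over `t`, when element `e` is
independently selected with probability `y e` and succeeds at `t` with probability `p t e`. -/
def coverage {E T : Type*} [Fintype E] [MeasurableSpace T] (ν : Measure T) (p : T → E → ℝ)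
    (y : E → ℝ) : ℝ≥0∞ :=
  ∫⁻ t, ENNReal.ofReal (1 - ∏ e, (1 - y e * p t e)) ∂ν

/-! ### Swap rounding of convex combinations of bases -/

section Rounding

variable {E T : Type*} [Fintype E] [DecidableEq E] [MeasurableSpace T] {ν : Measure T}
  {p : T → E → ℝ}

theorem one_sub_prod_nonneg {q y : E → ℝ} (hq : ∀ e, q e ∈ Set.Icc (0 : ℝ) 1)
    (hy : ∀ e, y e ∈ Set.Icc (0 : ℝ) 1) : 0 ≤ 1 - ∏ e, (1 - y e * q e) := by
  refine sub_nonneg.2 (Finset.prod_le_one (fun e _ => ?_) fun e _ => ?_)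
  · have := mul_le_one₀ (hy e).2 (hq e).1 (hq e).2
    linarith
  · have := mul_nonneg (hy e).1 (hq e).1
    linarith

theorem measurable_coverage_integrand (hm : ∀ e, Measurable fun t => p t e) (y : E → ℝ) :
    Measurable fun t => ENNReal.ofReal (1 - ∏ e, (1 - y e * p t e)) := by
  fun_prop

/-- The integrand of `coverage` is convex in the direction that trades `j` for `i`. -/
theorem one_sub_prod_convex {q y y₁ y₂ : E → ℝ} {a b : ℝ} {i j : E} (hij : i ≠ j)
    (hq : ∀ e, q e ∈ Set.Icc (0 : ℝ) 1) (hy : ∀ e, y e ∈ Set.Icc (0 : ℝ) 1)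
    (ha : 0 ≤ a) (hb : 0 ≤ b)
    (hi₁ : y₁ i = y i + a) (hj₁ : y₁ j = y j - a) (hi₂ : y₂ i = y i - b) (hj₂ : y₂ j = y j + b)
    (h₁ : ∀ k, k ≠ i → k ≠ j → y₁ k = y k) (h₂ : ∀ k, k ≠ i → k ≠ j → y₂ k = y k) :
    (a + b) * (1 - ∏ e, (1 - y e * q e)) ≤
      b * (1 - ∏ e, (1 - y₁ e * q e)) + a * (1 - ∏ e, (1 - y₂ e * q e)) := by
  have split : ∀ w : E → ℝ, (∀ k, k ≠ i → k ≠ j → w k = y k) →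
      ∏ e, (1 - w e * q e) = (1 - w i * q i) * ((1 - w j * q j) *
        ∏ e ∈ (Finset.univ.erase i).erase j, (1 - y e * q e)) := fun w hw => by
    rw [← Finset.mul_prod_erase _ _ (Finset.mem_univ i),
      ← Finset.mul_prod_erase _ _ (Finset.mem_erase.2 ⟨hij.symm, Finset.mem_univ j⟩)]
    congr 2
    refine Finset.prod_congr rfl fun e he => ?_
    simp only [Finset.mem_erase] at he
    rw [hw e he.2.1 he.1]
  have hC : 0 ≤ ∏ e ∈ (Finset.univ.erase i).erase j, (1 - y e * q e) :=
    Finset.prod_nonneg fun e _ => by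
      have := mul_le_one₀ (hy e).2 (hq e).1 (hq e).2
      linarith
  rw [split y fun _ _ _ => rfl, split y₁ h₁, split y₂ h₂, hi₁, hj₁, hi₂, hj₂]
  generalize ∏ e ∈ (Finset.univ.erase i).erase j, (1 - y e * q e) = C at hC
  -- Shifting mass `s` from `j` to `i` changes the product by a quadratic in `s` with leading
  -- coefficient `-C * q i * q j`. With weights `b` and `a` the linear terms cancel, and this is the
  -- remaining gap.
  have key : 0 ≤ C * (q i * q j) * (b * a ^ 2 + a * b ^ 2) :=
    mul_nonneg (mul_nonneg hC (mul_nonneg (hq i).1 (hq j).1)) (by positivity)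
  nlinarith [key]

theorem coverage_convex (hm : ∀ e, Measurable fun t => p t e)
    (hp : ∀ t e, p t e ∈ Set.Icc (0 : ℝ) 1) {y y₁ y₂ : E → ℝ} {a b : ℝ} {i j : E} (hij : i ≠ j)
    (hy : ∀ e, y e ∈ Set.Icc (0 : ℝ) 1) (hy₁ : ∀ e, y₁ e ∈ Set.Icc (0 : ℝ) 1)
    (hy₂ : ∀ e, y₂ e ∈ Set.Icc (0 : ℝ) 1) (ha : 0 ≤ a) (hb : 0 ≤ b)
    (hi₁ : y₁ i = y i + a) (hj₁ : y₁ j = y j - a) (hi₂ : y₂ i = y i - b) (hj₂ : y₂ j = y j + b)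
    (h₁ : ∀ k, k ≠ i → k ≠ j → y₁ k = y k) (h₂ : ∀ k, k ≠ i → k ≠ j → y₂ k = y k) :
    ENNReal.ofReal (a + b) * coverage ν p y ≤
      ENNReal.ofReal b * coverage ν p y₁ + ENNReal.ofReal a * coverage ν p y₂ := by
  unfold coverage
  rw [← lintegral_const_mul _ (measurable_coverage_integrand hm y),
    ← lintegral_const_mul _ (measurable_coverage_integrand hm y₁),
    ← lintegral_const_mul _ (measurable_coverage_integrand hm y₂),
    ← lintegral_add_left ((measurable_coverage_integrand hm y₁).const_mul _)]
  refine lintegral_mono fun t => ?_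
  simp only
  rw [← ENNReal.ofReal_mul (by positivity), ← ENNReal.ofReal_mul hb, ← ENNReal.ofReal_mul ha,
    ← ENNReal.ofReal_add (mul_nonneg hb (one_sub_prod_nonneg (hp t) hy₁))
      (mul_nonneg ha (one_sub_prod_nonneg (hp t) hy₂))]
  exact ENNReal.ofReal_le_ofReal
    (one_sub_prod_convex hij (hp t) hy ha hb hi₁ hj₁ hi₂ hj₂ h₁ h₂)

theorem indicatorVec_mem_Icc (B : Finset E) (e : E) : indicatorVec B e ∈ Set.Icc (0 : ℝ) 1 := by
  unfold indicatorVec; split_ifs <;> simp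

/-- Swap rounding of a combination of two bases. -/
theorem exists_isBase_merge (hm : ∀ e, Measurable fun t => p t e)
    (hp : ∀ t e, p t e ∈ Set.Icc (0 : ℝ) 1) (M : Matroid E) {a b : ℝ} (ha : 0 ≤ a) (hb : 0 ≤ b)
    {z : E → ℝ} (hz : ∀ e, 0 ≤ z e) (hz' : ∀ e, z e + (a + b) ≤ 1) (n : ℕ) :
    ∀ B₁ B₂ : Finset E, M.IsBase (B₁ : Set E) → M.IsBase (B₂ : Set E) → (B₁ \ B₂).card = n →
    ∃ B : Finset E, M.IsBase (B : Set E) ∧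
      coverage ν p (fun e => z e + (a * indicatorVec B₁ e + b * indicatorVec B₂ e)) ≤
        coverage ν p (fun e => z e + (a + b) * indicatorVec B e) := by
  induction n with
  | zero =>
    intro B₁ B₂ h₁ h₂ hn
    have hsub : B₁ ⊆ B₂ := by simpa using hn
    have : B₁ = B₂ := by exact_mod_cast h₁.eq_of_subset_isBase h₂ (by exact_mod_cast hsub)
    subst this
    exact ⟨B₁, h₁, le_of_eq (by congr 1; ext e; ring)⟩
  | succ n ih =>
    intro B₁ B₂ h₁ h₂ hn
    -- The factor `a + b` is cancelled at the end, so the zero case is separate.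
    rcases (add_nonneg ha hb).eq_or_lt with hab | hab
    · have ha0 : a = 0 := by linarith
      have hb0 : b = 0 := by linarith
      exact ⟨B₁, h₁, by simp [ha0, hb0]⟩
    obtain ⟨j, hj⟩ : (B₁ \ B₂).Nonempty := Finset.card_pos.1 (by omega)
    obtain ⟨hj₁, hj₂⟩ := Finset.mem_sdiff.1 hj
    obtain ⟨i, hi₂, hi₁, hB₁, hB₂⟩ := h₁.symm_exchange h₂ (e := j) (by simpa) (by simpa)
    have hi₁ : i ∉ B₁ := by simpa using hi₁
    have hi₂ : i ∈ B₂ := by simpa using hi₂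
    have hij : i ≠ j := fun h => hi₁ (h ▸ hj₁)
    have card_erase : ((B₁ \ B₂).erase j).card = n := by
      rw [Finset.card_erase_of_mem hj, hn]; rfl
    -- The swap in `B₁` moves the vector by `a` from `j` to `i`; the swap in `B₂` moves it by `b`
    -- the opposite way. Either one removes `j` from the difference `B₁ \ B₂`.
    obtain ⟨C₁, hC₁, hle₁⟩ := ih (insert i (B₁.erase j)) B₂ (by simpa using hB₁) h₂ (by
      rw [← card_erase]; congr 1; ext k; simp only [Finset.mem_sdiff, Finset.mem_insert,
        Finset.mem_erase]; grind)
    obtain ⟨C₂, hC₂, hle₂⟩ := ih B₁ (insert j (B₂.erase i)) h₁ (by simpa using hB₂) (by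
      rw [← card_erase]; congr 1; ext k; simp only [Finset.mem_sdiff, Finset.mem_insert,
        Finset.mem_erase]; grind)
    have range : ∀ (D₁ D₂ : Finset E) (e : E),
        z e + (a * indicatorVec D₁ e + b * indicatorVec D₂ e) ∈ Set.Icc (0 : ℝ) 1 := by
      intro D₁ D₂ e
      have k₁ := indicatorVec_mem_Icc D₁ e
      have k₂ := indicatorVec_mem_Icc D₂ e
      have := mul_nonneg ha k₁.1
      have := mul_nonneg hb k₂.1
      have := mul_le_of_le_one_right ha k₁.2
      have := mul_le_of_le_one_right hb k₂.2
      exact ⟨by linarith [hz e], by linarith [hz' e]⟩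
    -- The current coverage is at most a weighted average over the two swaps, so the better of `C₁`
    -- and `C₂` does not lose.
    have key := coverage_convex (ν := ν) hm hp hij (range B₁ B₂) (range (insert i (B₁.erase j)) B₂)
      (range B₁ (insert j (B₂.erase i))) ha hb
      (by simp [indicatorVec, hi₁, hi₂]; ring) (by simp [indicatorVec, hj₁, hj₂, hij.symm])
      (by simp [indicatorVec, hi₁, hi₂, hij]) (by simp [indicatorVec, hj₁, hj₂]; ring)
      (by intro k hki hkj; simp [indicatorVec, hki, hkj])
      (by intro k hki hkj; simp [indicatorVec, hki, hkj])
    have hM : ∃ B : Finset E, M.IsBase (B : Set E) ∧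
        coverage ν p (fun e => z e + (a + b) * indicatorVec C₁ e) ≤
          coverage ν p (fun e => z e + (a + b) * indicatorVec B e) ∧
        coverage ν p (fun e => z e + (a + b) * indicatorVec C₂ e) ≤
          coverage ν p (fun e => z e + (a + b) * indicatorVec B e) := by
      rcases le_total (coverage ν p (fun e => z e + (a + b) * indicatorVec C₁ e))
        (coverage ν p (fun e => z e + (a + b) * indicatorVec C₂ e)) with h | h
      · exact ⟨C₂, hC₂, h, le_rfl⟩
      · exact ⟨C₁, hC₁, le_rfl, h⟩
    obtain ⟨B, hB, hle₁', hle₂'⟩ := hM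
    refine ⟨B, hB, ?_⟩
    have key' := key.trans (add_le_add (mul_le_mul_right (hle₁.trans hle₁') _)
      (mul_le_mul_right (hle₂.trans hle₂') _))
    rw [← add_mul, ← ENNReal.ofReal_add hb ha, add_comm b a] at key'
    exact (ENNReal.mul_le_mul_iff_right (by simpa using hab) ENNReal.ofReal_ne_top).1 key'

/-- Swap rounding: the coverage of a convex combination of bases is attained by some base. -/
theorem exists_isBase_coverage_le (hm : ∀ e, Measurable fun t => p t e)
    (hp : ∀ t e, p t e ∈ Set.Icc (0 : ℝ) 1) (M : Matroid E) {ι : Type*}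
    (B : ι → Finset E) (hB : ∀ i, M.IsBase (B i : Set E)) (w : ι → ℝ) (hw : ∀ i, 0 ≤ w i)
    (hne : ∃ B₀ : Finset E, M.IsBase (B₀ : Set E)) (s : Finset ι) :
    ∀ z : E → ℝ, (∀ e, 0 ≤ z e) → (∀ e, z e + ∑ i ∈ s, w i ≤ 1) →
    ∃ C : Finset E, M.IsBase (C : Set E) ∧
      coverage ν p (fun e => z e + ∑ i ∈ s, w i * indicatorVec (B i) e) ≤
        coverage ν p (fun e => z e + (∑ i ∈ s, w i) * indicatorVec C e) := by
  classical
  induction s using Finset.induction_on with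
  | empty =>
    intro z _ _
    obtain ⟨B₀, hB₀⟩ := hne
    exact ⟨B₀, hB₀, by simp⟩
  | insert i s hi ih =>
    intro z hz hz'
    simp only [Finset.sum_insert hi] at hz' ⊢
    have hs : 0 ≤ ∑ i ∈ s, w i := Finset.sum_nonneg fun i _ => hw i
    -- The base not yet merged is absorbed into the offset `z` while the others are rounded to `C`;
    -- then `B i` and `C` are merged.
    obtain ⟨C, hC, hle⟩ := ih (fun e => z e + w i * indicatorVec (B i) e)
      (fun e => add_nonneg (hz e) (mul_nonneg (hw i) (indicatorVec_mem_Icc _ e).1))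
      (fun e => by
        have := mul_le_of_le_one_right (hw i) (indicatorVec_mem_Icc (B i) e).2
        linarith [hz' e])
    obtain ⟨D, hD, hle'⟩ := exists_isBase_merge (ν := ν) hm hp M (hw i) hs hz hz' _ (B i) C (hB i)
      hC rfl
    refine ⟨D, hD, ?_⟩
    simp only [add_assoc] at hle hle'
    exact hle.trans hle'

end Rounding

variable {E : Type*} [Fintype E] [DecidableEq E]

/-! ### Independence of a coordinate from events about the others -/

section Independence

instance (I : Instance E) : IsProbabilityMeasure I.law := by
  have := I.isProb
  unfold Instance.law
  infer_instance

/-- An event that does not depend on coordinate `e` is independent of the utilities of `e`. -/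
theorem Instance.lintegral_indicator_mul (I : Instance E) {A : Set (State E)}
    (hA : MeasurableSet A) {e : E} (hAe : ∀ ω v, Function.update ω e v ∈ A ↔ ω ∈ A)
    {f : ℝ≥0 × ℝ≥0 → ℝ≥0∞} (hf : Measurable f) :
    ∫⁻ ω, A.indicator 1 ω * f (ω e) ∂I.law = I.law A * ∫⁻ ω, f (ω e) ∂I.law := by
  have := I.isProb
  have hind : ProbabilityTheory.iIndepFun (fun (i : E) (ω : State E) => ω i) I.law :=
    ProbabilityTheory.iIndepFun_pi (X := fun _ => id) fun _ => aemeasurable_id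
  have hpair := hind.indepFun_finset ({e}ᶜ) {e} disjoint_compl_left fun i => measurable_pi_apply i
  -- Filling coordinate `e` with the dummy value `0` exhibits the indicator of `A` as a function of
  -- the other coordinates, by `hAe`.
  let ext : ((({e}ᶜ : Finset E) : Type _) → ℝ≥0 × ℝ≥0) → State E :=
    fun o k => if h : k ∈ ({e}ᶜ : Finset E) then o ⟨k, h⟩ else 0
  have hext : Measurable ext := by
    refine measurable_pi_lambda _ fun k => ?_
    by_cases h : k ∈ ({e}ᶜ : Finset E)
    · simp only [ext, h, dif_pos]
      exact measurable_pi_apply _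
    · simp only [ext, h, dif_neg, not_false_eq_true]
      exact measurable_const
  have hφ : Measurable fun o => A.indicator (1 : State E → ℝ≥0∞) (ext o) :=
    (measurable_one.indicator hA).comp hext
  have hψ : Measurable fun o : (({e} : Finset E) : Type _) → ℝ≥0 × ℝ≥0 =>
      f (o ⟨e, Finset.mem_singleton_self e⟩) := hf.comp (measurable_pi_apply _)
  have hcomp := hpair.comp hφ hψ
  have heq : ∀ ω : State E, ext (fun i : (({e}ᶜ : Finset E) : Type _) => ω i) =
      Function.update ω e 0 := fun ω => by
    funext k
    by_cases h : k = e
    · subst h; simp [ext]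
    · simp [ext, h]
  have hfun : ((fun o => A.indicator (1 : State E → ℝ≥0∞) (ext o)) ∘
      fun (ω : State E) (i : (({e}ᶜ : Finset E) : Type _)) => ω i) = A.indicator 1 := by
    funext ω
    simp only [Function.comp, heq]
    by_cases h : ω ∈ A
    · rw [Set.indicator_of_mem h, Set.indicator_of_mem ((hAe ω 0).2 h)]; rfl
    · rw [Set.indicator_of_notMem h, Set.indicator_of_notMem (mt (hAe ω 0).1 h)]
  rw [hfun] at hcomp
  have := ProbabilityTheory.lintegral_mul_eq_lintegral_mul_lintegral_of_indepFun
    (measurable_one.indicator hA) (hf.comp (measurable_pi_apply e)) hcomp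
  rw [lintegral_indicator_one hA] at this
  exact this

theorem Instance.law_inter (I : Instance E) {A : Set (State E)}
    (hA : MeasurableSet A) {e : E} (hAe : ∀ ω v, Function.update ω e v ∈ A ↔ ω ∈ A)
    {s : Set (ℝ≥0 × ℝ≥0)} (hs : MeasurableSet s) :
    I.law (A ∩ {ω | ω e ∈ s}) = I.law A * I.law {ω | ω e ∈ s} := by
  have hs' : MeasurableSet {ω : State E | ω e ∈ s} := measurable_pi_apply e hs
  have h := I.lintegral_indicator_mul hA hAe (f := s.indicator 1) (measurable_one.indicator hs)
  rw [← lintegral_indicator_one (hA.inter hs'), ← lintegral_indicator_one hs',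
    Set.inter_indicator_one]
  exact h

end Independence

/-! ### Dynamics and measurability of adaptive strategies -/

section Strategies

variable {I : Instance E} (σ : I.ProbingStrategy)

theorem Instance.ProbingStrategy.subset_step (ω : State E) (S : Finset E) : S ⊆ σ.step ω S := by
  unfold step
  split
  · exact subset_rfl
  · exact Finset.subset_insert _ _

/-- A strategy reads only probed coordinates, so runs in states differing at `e` alone coincide as
long as `e` is unprobed. -/
theorem Instance.ProbingStrategy.iterate_congr {ω ω' : State E} {e : E}
    (h : ∀ k, k ≠ e → ω k = ω' k) (n : ℕ) :
    e ∉ (σ.step ω)^[n] ∅ → (σ.step ω')^[n] ∅ = (σ.step ω)^[n] ∅ := by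
  induction n with
  | zero => exact fun _ => rfl
  | succ n ih =>
    rw [Function.iterate_succ_apply', Function.iterate_succ_apply']
    intro he
    have he' : e ∉ (σ.step ω)^[n] ∅ := fun h => he (σ.subset_step ω _ h)
    rw [ih he']
    generalize (σ.step ω)^[n] ∅ = S at he'
    unfold step
    have : (fun k : S => ω' k) = fun k : S => ω k :=
      funext fun k => (h k fun hk => he' (hk ▸ k.2)).symm
    rw [this]

/-- Whether `e` is probed does not depend on the utilities of `e`. -/
theorem Instance.ProbingStrategy.mem_probed_update (ω : State E) (e : E) (v : ℝ≥0 × ℝ≥0) :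
    e ∈ σ.probed (Function.update ω e v) ↔ e ∈ σ.probed ω := by
  have h : ∀ k, k ≠ e → Function.update ω e v k = ω k := fun k hk => by simp [hk]
  constructor <;> intro he <;> by_contra hn
  · have := σ.iterate_congr (ω := ω) (fun k hk => (h k hk).symm) (Fintype.card E) hn
    exact hn (by rw [probed, ← this]; exact he)
  · have := σ.iterate_congr (ω' := ω) h (Fintype.card E) hn
    exact hn (by rw [probed, ← this]; exact he)

theorem Instance.ProbingStrategy.iterate_feasible (ω : State E) (n : ℕ) :
    (σ.step ω)^[n] ∅ ∈ I.outer.feasible := by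
  induction n with
  | zero => exact I.outer.empty_mem
  | succ n ih =>
    rw [Function.iterate_succ_apply']
    generalize (σ.step ω)^[n] ∅ = S at ih
    unfold step
    split
    · exact ih
    · next e he => exact (σ.next_feasible S _ e he).2

theorem Instance.ProbingStrategy.measurableSet_iterate (n : ℕ) (S : Finset E) :
    MeasurableSet {ω : State E | (σ.step ω)^[n] ∅ = S} := by
  induction n generalizing S with
  | zero => exact MeasurableSet.const (∅ = S)
  | succ n ih =>
    have hnext : ∀ (S' : Finset E) (o : Option E),
        MeasurableSet {ω : State E | σ.next S' (fun e => ω e) = o} := by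
      intro S' o
      have hr : Measurable fun (ω : State E) (e : S') => ω e :=
        measurable_pi_lambda _ fun e => measurable_pi_apply _
      have hsome : ∀ e, MeasurableSet {ω : State E | σ.next S' (fun e => ω e) = some e} :=
        fun e => hr (σ.measurable_next S' e)
      cases o with
      | some e => exact hsome e
      | none =>
        have : {ω : State E | σ.next S' (fun e => ω e) = none} =
            (⋃ e, {ω : State E | σ.next S' (fun e => ω e) = some e})ᶜ := by
          ext ω
          simp [Option.eq_none_iff_forall_ne_some]
        rw [this]
        exact (MeasurableSet.iUnion hsome).compl
    have : {ω : State E | (σ.step ω)^[n + 1] ∅ = S} =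
        ⋃ (S' : Finset E) (o : Option E), {ω : State E | (σ.step ω)^[n] ∅ = S'} ∩
          ({ω | σ.next S' (fun e => ω e) = o} ∩
            {_ω | (match o with | none => S' | some e => insert e S') = S}) := by
      ext ω
      simp only [Set.mem_ofPred_eq, Set.mem_iUnion, Set.mem_inter_iff, Function.iterate_succ_apply']
      constructor
      · intro h
        exact ⟨_, _, rfl, rfl, h⟩
      · rintro ⟨S', o, rfl, rfl, h⟩
        exact h
    rw [this]
    exact MeasurableSet.iUnion fun S' => MeasurableSet.iUnion fun o =>
      (ih S').inter ((hnext S' o).inter (MeasurableSet.const _))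

theorem Instance.ProbingStrategy.measurableSet_probed_eq (S : Finset E) :
    MeasurableSet {ω : State E | σ.probed ω = S} :=
  σ.measurableSet_iterate _ S

theorem Instance.ProbingStrategy.measurableSet_mem_probed (e : E) :
    MeasurableSet {ω : State E | e ∈ σ.probed ω} := by
  have : {ω : State E | e ∈ σ.probed ω} =
      ⋃ (S : Finset E) (_ : e ∈ S), {ω : State E | σ.probed ω = S} := by
    ext ω; simp
  rw [this]
  exact MeasurableSet.iUnion fun S => MeasurableSet.iUnion fun _ => σ.measurableSet_probed_eq S

end Strategies

/-! ### The expected maximum as a coverage integral -/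

section MaxUtility

/-- The largest principal's utility among the elements of `F`. -/
def maxUtil (ω : State E) (F : Finset E) : ℝ≥0 := F.sup fun e => (ω e).1

/-- The probability that the principal's utility of `e` exceeds `t`. -/
def Instance.tailProb (I : Instance E) (t : ℝ) (e : E) : ℝ :=
  I.law.real {ω | t < ((ω e).1 : ℝ)}

theorem lt_maxUtil_iff {ω : State E} {F : Finset E} {t : ℝ} (ht : 0 ≤ t) :
    t < (maxUtil ω F : ℝ) ↔ ∃ e ∈ F, t < ((ω e).1 : ℝ) := by
  lift t to ℝ≥0 using ht
  simp [maxUtil, Finset.lt_sup_iff]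

theorem Instance.tailProb_mem_Icc (I : Instance E) (t : ℝ) (e : E) :
    I.tailProb t e ∈ Set.Icc (0 : ℝ) 1 :=
  ⟨measureReal_nonneg, measureReal_le_one⟩

theorem Instance.measurable_tailProb (I : Instance E) (e : E) :
    Measurable fun t => I.tailProb t e := by
  have : Antitone fun t => I.tailProb t e := fun s t hst =>
    measureReal_mono fun ω (hω : t < _) => hst.trans_lt hω
  exact this.measurable

theorem lintegral_nnreal_eq_tail {Ω : Type*} [MeasurableSpace Ω] (ν : Measure Ω) {f : Ω → ℝ≥0}
    (hf : Measurable f) :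
    ∫⁻ ω, (f ω : ℝ≥0∞) ∂ν = ∫⁻ t in Set.Ioi (0 : ℝ), ν {ω | t < (f ω : ℝ)} := by
  rw [← lintegral_eq_lintegral_meas_lt ν (f := fun ω => (f ω : ℝ))
    (Filter.Eventually.of_forall fun ω => (f ω).2) hf.coe_nnreal_real.aemeasurable]
  simp

theorem measurable_maxUtil (F : Finset E) : Measurable fun ω : State E => maxUtil ω F := by
  unfold maxUtil
  induction F using Finset.induction_on with
  | empty => exact measurable_const
  | insert e F he ih =>
    simp only [Finset.sup_insert]
    exact (measurable_pi_apply e).fst.sup ih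

/-- The maximum stays at most `t` iff every coordinate in `F` does, and by independence that
probability is a product. -/
theorem Instance.measure_lt_maxUtil (I : Instance E) {t : ℝ} (ht : 0 ≤ t) (F : Finset E) :
    I.law {ω | t < (maxUtil ω F : ℝ)} =
      ENNReal.ofReal (1 - ∏ e, (1 - indicatorVec F e * I.tailProb t e)) := by
  have := I.isProb
  have hset : {ω : State E | t < (maxUtil ω F : ℝ)} =
      (Set.pi Set.univ fun e => if e ∈ F then {v : ℝ≥0 × ℝ≥0 | t < (v.1 : ℝ)}ᶜ else Set.univ)ᶜ := by
    ext ω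
    simp only [Set.mem_ofPred_eq, lt_maxUtil_iff ht, Set.mem_compl_iff, Set.mem_univ_pi, not_forall]
    refine exists_congr fun e => ?_
    by_cases he : e ∈ F <;> simp [he]
  have hms : MeasurableSet {v : ℝ≥0 × ℝ≥0 | t < (v.1 : ℝ)} :=
    measurableSet_lt measurable_const measurable_fst.coe_nnreal_real
  have hm : MeasurableSet (Set.pi Set.univ fun e : E =>
      if e ∈ F then {v : ℝ≥0 × ℝ≥0 | t < (v.1 : ℝ)}ᶜ else Set.univ) := by
    refine MeasurableSet.univ_pi fun e => ?_
    split_ifs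
    · exact hms.compl
    · exact MeasurableSet.univ
  have htail : ∀ e, I.tailProb t e = (I.μ e).real {v | t < (v.1 : ℝ)} := fun e => by
    have := (measurePreserving_eval I.μ e).measureReal_preimage hms.nullMeasurableSet
    exact this
  rw [hset, ← ofReal_measureReal, probReal_compl_eq_one_sub hm]
  congr 2
  rw [Measure.real, Instance.law, Measure.pi_pi, ENNReal.toReal_prod]
  refine Finset.prod_congr rfl fun e _ => ?_
  by_cases he : e ∈ F
  · simp only [he, if_true, indicatorVec, one_mul, htail]
    exact probReal_compl_eq_one_sub hms
  · simp [he, indicatorVec]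

theorem Instance.lintegral_maxUtil (I : Instance E) (F : Finset E) :
    ∫⁻ ω, (maxUtil ω F : ℝ≥0∞) ∂I.law =
      coverage (volume.restrict (Set.Ioi 0)) I.tailProb (indicatorVec F) := by
  rw [lintegral_nnreal_eq_tail _ (measurable_maxUtil F), coverage]
  exact setLIntegral_congr_fun measurableSet_Ioi fun t ht => I.measure_lt_maxUtil (le_of_lt ht) F

theorem xUtil_outcomes (ω : State E) (G : Finset E) :
    xUtil (outcomes ω G) = ∑ e ∈ G, (ω e).1 := by
  unfold xUtil outcomes
  rw [Finset.sum_image fun a _ b _ h => congrArg Prod.fst h]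

theorem Instance.u_le_maxUtil (I : Instance E) (hinner : I.inner.IsUniform 1) (ω : State E)
    (F : Finset E) : I.u ω F ≤ maxUtil ω F := by
  unfold Instance.u
  refine Finset.sup_le fun G hG => ?_
  classical
  rw [Finset.mem_filter, Finset.mem_powerset] at hG
  obtain ⟨hGF, hG⟩ := hG
  rw [xUtil_outcomes]
  rcases Nat.le_one_iff_eq_zero_or_eq_one.1 ((hinner G).1 hG) with h | h
  · rw [Finset.card_eq_zero.1 h]; simp
  · obtain ⟨e, rfl⟩ := Finset.card_eq_one.1 h
    rw [Finset.sum_singleton]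
    exact Finset.le_sup (f := fun e => (ω e).1) (hGF (Finset.mem_singleton_self e))

end MaxUtility

/-! ### The adaptivity gap -/

section AdaptivityGap

/-- On `[0, 1]` this is the chord of the concave function `1 - exp (-s)`; beyond `1`, monotonicity
suffices. -/
theorem one_sub_exp_mul_min_le (s : ℝ) (hs : 0 ≤ s) :
    (1 - 1 / Real.exp 1) * min 1 s ≤ 1 - Real.exp (-s) := by
  have hexp : 1 / Real.exp 1 = Real.exp (-1) := by rw [Real.exp_neg, one_div]
  rw [hexp]
  rcases le_total 1 s with h | h
  · rw [min_eq_left h]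
    have := Real.exp_le_exp.2 (neg_le_neg h)
    linarith
  · rw [min_eq_right h]
    have := convexOn_exp.2 (Set.mem_univ 0) (Set.mem_univ (-1)) (sub_nonneg.2 h) hs (by ring)
    simp only [smul_eq_mul, mul_zero, zero_add, Real.exp_zero, mul_one, mul_neg] at this
    linarith

theorem one_sub_exp_neg_sum_le {ι : Type*} (s : Finset ι) (r : ι → ℝ) (hr : ∀ i, r i ≤ 1) :
    1 - Real.exp (-∑ i ∈ s, r i) ≤ 1 - ∏ i ∈ s, (1 - r i) := by
  rw [← Finset.sum_neg_distrib, Real.exp_sum]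
  refine sub_le_sub_left (Finset.prod_le_prod (fun i _ => sub_nonneg.2 (hr i)) fun i _ => ?_) 1
  have := Real.add_one_le_exp (-r i)
  linarith

variable {I : Instance E} (σ : I.ProbingStrategy)

theorem Instance.ProbingStrategy.measurable_maxUtil_probed :
    Measurable fun ω : State E => maxUtil ω (σ.probed ω) := by
  have : (fun ω : State E => maxUtil ω (σ.probed ω)) = fun ω =>
      ∑ S : Finset E, {ω | σ.probed ω = S}.indicator (fun ω => maxUtil ω S) ω := by
    funext ω
    rw [Finset.sum_eq_single (σ.probed ω)]
    · simp
    · intro S _ hS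
      exact Set.indicator_of_notMem (fun h => hS (Eq.symm h)) _
    · simp
  rw [this]
  exact Finset.measurable_sum _ fun S _ =>
    (measurable_maxUtil S).indicator (σ.measurableSet_probed_eq S)

/-- Union bound over the probed elements; each term factors because the decision to probe `e`
ignores the utilities of `e`. -/
theorem Instance.ProbingStrategy.measureReal_lt_maxUtil_probed_le {t : ℝ} (ht : 0 ≤ t) :
    I.law.real {ω | t < (maxUtil ω (σ.probed ω) : ℝ)} ≤
      ∑ e, I.law.real {ω | e ∈ σ.probed ω} * I.tailProb t e := by
  have hset : {ω : State E | t < (maxUtil ω (σ.probed ω) : ℝ)} =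
      ⋃ e, ({ω | e ∈ σ.probed ω} ∩ {ω | t < ((ω e).1 : ℝ)}) := by
    ext ω
    simp [lt_maxUtil_iff ht]
  rw [hset]
  refine (measureReal_iUnion_fintype_le _).trans (Finset.sum_le_sum fun e _ => le_of_eq ?_)
  have := I.law_inter (σ.measurableSet_mem_probed e) (e := e)
    (fun ω v => σ.mem_probed_update ω e v) (s := {v | t < (v.1 : ℝ)})
    (measurableSet_lt measurable_const measurable_fst.coe_nnreal_real)
  rw [Measure.real, Instance.tailProb, Measure.real, Measure.real, ← ENNReal.toReal_mul]
  exact congrArg _ this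

/-- The adaptivity gap: some base of the outer matroid achieves a `1 - 1/e` fraction of any
adaptive strategy in expectation. -/
theorem Instance.ProbingStrategy.exists_isBase_adaptivity_gap (hinner : I.inner.IsUniform 1)
    {M : Matroid E} (hM : ∀ F : Finset E, F ∈ I.outer.feasible ↔ M.Indep (F : Set E)) :
    ∃ B : Finset E, M.IsBase (B : Set E) ∧
      ENNReal.ofReal (1 - 1 / Real.exp 1) * ∫⁻ ω, (I.u ω (σ.probed ω) : ℝ≥0∞) ∂I.law ≤
        ∫⁻ ω, (maxUtil ω B : ℝ≥0∞) ∂I.law := by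
  -- An infeasible `S` gets an arbitrary base; it is probed with probability `0`.
  have hext : ∀ S : Finset E, ∃ B : Finset E, M.IsBase (B : Set E) ∧
      (S ∈ I.outer.feasible → S ⊆ B) := fun S => by
    by_cases hS : S ∈ I.outer.feasible
    · obtain ⟨B, hB, hSB⟩ := ((hM S).1 hS).exists_isBase_superset
      refine ⟨B.toFinite.toFinset, by simpa using hB, fun _ e he => ?_⟩
      simpa using hSB he
    · obtain ⟨B, hB⟩ := M.exists_isBase
      exact ⟨B.toFinite.toFinset, by simpa using hB, fun h => absurd h hS⟩
  choose B hB hSB using hext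
  set w : Finset E → ℝ := fun S => I.law.real {ω | σ.probed ω = S} with hw
  have hsum : ∀ P : Finset E → Prop, ∀ _ : DecidablePred P,
      I.law.real {ω | P (σ.probed ω)} = ∑ S : Finset E, w S * if P S then 1 else 0 := by
    intro P _
    have : {ω | P (σ.probed ω)} = ⋃ S ∈ Finset.univ.filter P, {ω | σ.probed ω = S} := by
      ext ω; simp
    rw [this, measureReal_biUnion_finset]
    · simp [Finset.sum_filter, hw]
    · intro S _ S' _ hne
      exact Set.disjoint_left.2 fun ω (h : _ = _) (h' : _ = _) => hne (h.symm.trans h')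
    · exact fun S _ => σ.measurableSet_probed_eq S
  have hw1 : ∑ S, w S = 1 := by
    have := hsum (fun _ => True) inferInstance
    simpa using this.symm
  have hw0 : ∀ S, 0 ≤ w S := fun S => measureReal_nonneg
  set y : E → ℝ := fun e => ∑ S, w S * indicatorVec (B S) e with hy
  have hprobed : ∀ e, I.law.real {ω | e ∈ σ.probed ω} ≤ y e := fun e => by
    rw [hsum (fun S => e ∈ S) inferInstance]
    refine Finset.sum_le_sum fun S _ => ?_
    by_cases hS : S ∈ I.outer.feasible
    · refine mul_le_mul_of_nonneg_left ?_ (hw0 S)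
      unfold indicatorVec
      by_cases he : e ∈ S
      · simp [he, hSB S hS he]
      · simp only [he, if_false]
        split_ifs <;> simp
    · have : w S = 0 := by
        have : {ω | σ.probed ω = S} = ∅ := by
          ext ω
          simp only [Set.mem_ofPred_eq, Set.mem_empty_iff_false, iff_false]
          rintro rfl
          exact hS (σ.iterate_feasible ω _)
        simp [hw, this]
      simp [this]
  have hy01 : ∀ e, y e ∈ Set.Icc (0 : ℝ) 1 := fun e => by
    refine ⟨Finset.sum_nonneg fun S _ => mul_nonneg (hw0 S) (indicatorVec_mem_Icc _ e).1, ?_⟩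
    rw [← hw1]
    exact Finset.sum_le_sum fun S _ => mul_le_of_le_one_right (hw0 S) (indicatorVec_mem_Icc _ e).2
  -- The weights sum to `1` and the offset is `0`, so rounding ends at the plain indicator of `C`.
  obtain ⟨C, hC, hle⟩ := exists_isBase_coverage_le (ν := volume.restrict (Set.Ioi (0 : ℝ)))
    I.measurable_tailProb I.tailProb_mem_Icc M B hB w hw0 ⟨B ∅, hB ∅⟩ Finset.univ (fun _ => 0)
    (fun _ => le_rfl) (fun _ => by rw [hw1, zero_add])
  simp only [zero_add, hw1, one_mul] at hle
  refine ⟨C, hC, ?_⟩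
  rw [I.lintegral_maxUtil]
  refine le_trans ?_ hle
  have hu : ∫⁻ ω, (I.u ω (σ.probed ω) : ℝ≥0∞) ∂I.law ≤
      ∫⁻ t in Set.Ioi (0 : ℝ), I.law {ω | t < (maxUtil ω (σ.probed ω) : ℝ)} := by
    rw [← lintegral_nnreal_eq_tail _ σ.measurable_maxUtil_probed]
    exact lintegral_mono fun ω => ENNReal.coe_le_coe.2 (I.u_le_maxUtil hinner ω _)
  refine (mul_le_mul_right hu _).trans ?_
  rw [← lintegral_const_mul' _ _ ENNReal.ofReal_ne_top]
  refine setLIntegral_mono' measurableSet_Ioi fun t ht => ?_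
  have ht : 0 ≤ t := le_of_lt ht
  have hc : 0 ≤ 1 - 1 / Real.exp 1 := by
    rw [sub_nonneg, div_le_one (Real.exp_pos 1)]
    exact Real.one_le_exp zero_le_one
  rw [← ofReal_measureReal, ← ENNReal.ofReal_mul hc]
  refine ENNReal.ofReal_le_ofReal ?_
  have hr0 : ∀ e, 0 ≤ y e * I.tailProb t e :=
    fun e => mul_nonneg (hy01 e).1 (I.tailProb_mem_Icc t e).1
  calc (1 - 1 / Real.exp 1) * I.law.real {ω | t < (maxUtil ω (σ.probed ω) : ℝ)}
      ≤ (1 - 1 / Real.exp 1) * min 1 (∑ e, y e * I.tailProb t e) := by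
        refine mul_le_mul_of_nonneg_left (le_min measureReal_le_one ?_) hc
        exact (σ.measureReal_lt_maxUtil_probed_le ht).trans <| Finset.sum_le_sum fun e _ =>
          mul_le_mul_of_nonneg_right (hprobed e) (I.tailProb_mem_Icc t e).1
    _ ≤ 1 - Real.exp (-∑ e, y e * I.tailProb t e) :=
        one_sub_exp_mul_min_le _ (Finset.sum_nonneg fun e _ => hr0 e)
    _ ≤ _ := one_sub_exp_neg_sum_le _ _ fun e =>
        mul_le_one₀ (hy01 e).2 (I.tailProb_mem_Icc t e).1 (I.tailProb_mem_Icc t e).2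

end AdaptivityGap

/-! ### Threshold policies and the prophet inequality -/

section ThresholdPolicy

/-- The policy accepting the single outcomes of elements of `F` whose principal's utility is at
least `τ`. -/
def Instance.thresholdPolicy (I : Instance E) (F : Finset E) (τ : ℝ≥0) :
    Set (Finset (Outcome E)) :=
  {T | ∃ e ∈ F, ∃ v ∈ (I.μ e).support, τ ≤ v.1 ∧ T = {(e, v)}}

variable {I : Instance E} {F : Finset E} {τ : ℝ≥0}

theorem subset_outcomes_singleton {ω : State E} {G : Finset E} {e : E} {v : ℝ≥0 × ℝ≥0} :
    {(e, v)} ⊆ outcomes ω G ↔ e ∈ G ∧ ω e = v := by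
  simp only [outcomes, Finset.singleton_subset_iff, Finset.mem_image, Prod.mk.injEq]
  constructor
  · rintro ⟨k, hk, rfl, rfl⟩
    exact ⟨hk, rfl⟩
  · rintro ⟨he, rfl⟩
    exact ⟨e, he, rfl, rfl⟩

theorem outcomes_eq_singleton_iff {ω : State E} {G : Finset E} {e : E} {v : ℝ≥0 × ℝ≥0} :
    outcomes ω G = {(e, v)} ↔ G = {e} ∧ ω e = v := by
  constructor
  · intro h
    obtain ⟨he, hv⟩ := subset_outcomes_singleton.1 h.ge
    refine ⟨Finset.eq_singleton_iff_unique_mem.2 ⟨he, fun k hk => ?_⟩, hv⟩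
    have : (k, ω k) ∈ outcomes ω G := Finset.mem_image_of_mem _ hk
    rw [h, Finset.mem_singleton] at this
    exact congrArg Prod.fst this
  · rintro ⟨rfl, rfl⟩
    simp [outcomes]

theorem mem_acceptable {R : Set (Finset (Outcome E))} {S T : Finset (Outcome E)} :
    T ∈ acceptable R S ↔ T ⊆ S ∧ T ∈ R := by
  classical
  rw [acceptable, Finset.mem_filter, Finset.mem_powerset]

theorem mem_acceptable_thresholdPolicy {ω : State E} {G : Finset E} {T : Finset (Outcome E)} :
    T ∈ acceptable (I.thresholdPolicy F τ) (outcomes ω G) ↔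
      ∃ e ∈ F, e ∈ G ∧ ω e ∈ (I.μ e).support ∧ τ ≤ (ω e).1 ∧ T = {(e, ω e)} := by
  rw [mem_acceptable]
  constructor
  · rintro ⟨hT, e, he, v, hv, hτ, rfl⟩
    obtain ⟨heG, rfl⟩ := subset_outcomes_singleton.1 hT
    exact ⟨e, he, heG, hv, hτ, rfl⟩
  · rintro ⟨e, he, heG, hv, hτ, rfl⟩
    exact ⟨subset_outcomes_singleton.2 ⟨heG, rfl⟩, e, he, _, hv, hτ, rfl⟩

theorem Instance.isPolicy_thresholdPolicy (hinner : I.inner.IsUniform 1) :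
    I.IsPolicy (I.thresholdPolicy F τ) := by
  refine ⟨?_, fun G => ?_⟩
  · rintro _ ⟨e, he, v, hv, -, rfl⟩
    refine ⟨by simpa [Instance.possibleOutcomes] using hv, by simp, ?_⟩
    rw [hinner]
    simp
  · have : {ω : State E | outcomes ω G ∈ I.thresholdPolicy F τ} =
        ⋃ e ∈ F, {ω : State E | G = {e}} ∩
          {ω | ω e ∈ (I.μ e).support ∩ {v : ℝ≥0 × ℝ≥0 | τ ≤ v.1}} := by
      ext ω
      simp only [Instance.thresholdPolicy, Set.mem_ofPred_eq, outcomes_eq_singleton_iff,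
        Set.mem_iUnion, Set.mem_inter_iff]
      constructor
      · rintro ⟨e, he, v, hv, hτ, hG, rfl⟩
        exact ⟨e, he, hG, hv, hτ⟩
      · rintro ⟨e, he, hG, hv, hτ⟩
        exact ⟨e, he, _, hv, hτ, hG, rfl⟩
    rw [this]
    refine Finset.measurableSet_biUnion _ fun e _ => (MeasurableSet.const _).inter ?_
    exact measurable_pi_apply e (Measure.isClosed_support.measurableSet.inter
      (measurableSet_le measurable_const measurable_fst))

/-- The strategy that probes all the elements of a feasible set `F`. -/
def Instance.probeAll (I : Instance E) (hF : F ∈ I.outer.feasible) : I.ProbingStrategy where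
  next S _ := if h : S ⊂ F then some (Finset.exists_of_ssubset h).choose else none
  measurable_next S e := MeasurableSet.const _
  next_feasible S _ e h := by
    split_ifs at h with hS
    obtain ⟨h₁, h₂⟩ := (Finset.exists_of_ssubset hS).choose_spec
    rw [Option.some.inj h] at h₁ h₂
    exact ⟨h₂, I.outer.down_closed (Finset.insert_subset h₁ hS.subset) hF⟩

theorem Instance.probed_probeAll (hF : F ∈ I.outer.feasible) (ω : State E) :
    (I.probeAll hF).probed ω = F := by
  have key : ∀ n, ((I.probeAll hF).step ω)^[n] ∅ ⊆ F ∧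
      min n F.card ≤ (((I.probeAll hF).step ω)^[n] ∅).card := by
    intro n
    induction n with
    | zero => simp
    | succ n ih =>
      rw [Function.iterate_succ_apply']
      generalize ((I.probeAll hF).step ω)^[n] ∅ = S at ih
      by_cases hS : S ⊂ F
      · obtain ⟨h₁, h₂⟩ := (Finset.exists_of_ssubset hS).choose_spec
        have : (I.probeAll hF).step ω S = insert (Finset.exists_of_ssubset hS).choose S := by
          simp [ProbingStrategy.step, probeAll, hS]
        rw [this, Finset.card_insert_of_notMem h₂]
        exact ⟨Finset.insert_subset h₁ hS.subset, by omega⟩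
      · have h : S = F := by
          by_contra hne
          exact hS (ih.1.ssubset_of_ne hne)
        have : (I.probeAll hF).step ω S = S := by
          simp [ProbingStrategy.step, probeAll, hS]
        rw [this, h]
        exact ⟨subset_rfl, min_le_right _ _⟩
  obtain ⟨h₁, h₂⟩ := key (Fintype.card E)
  rw [min_eq_right (Finset.card_le_univ F)] at h₂
  exact Finset.eq_of_subset_of_card_le h₁ h₂

/-- Outcomes outside `F` are never acceptable, so in every state probing all of `F` offers every
acceptable proposal that another strategy could reach. -/
theorem Instance.isAgentOptimal_probeAll (hF : F ∈ I.outer.feasible) :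
    I.IsAgentOptimal (I.thresholdPolicy F τ) (I.probeAll hF) := by
  refine fun σ' => lintegral_mono fun ω => ENNReal.coe_le_coe.2 (Finset.sup_mono fun T hT => ?_)
  rw [I.probed_probeAll hF]
  rw [mem_acceptable_thresholdPolicy] at hT ⊢
  obtain ⟨e, he, -, h⟩ := hT
  exact ⟨e, he, he, h⟩

/-- A pointwise lower bound on the principal's utility from any favorite proposal under a
threshold policy. -/
theorem thresholdPolicy_le_xUtil {ω : State E} (hω : ∀ e, ω e ∈ (I.μ e).support)
    {T : Finset (Outcome E)} (hT : IsFavorite (I.thresholdPolicy F τ) (outcomes ω F) T) :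
    ({ω : State E | ∃ e ∈ F, τ ≤ (ω e).1}.indicator 1 ω * (τ : ℝ≥0∞) +
      ∑ e ∈ F, {ω : State E | ∀ k ∈ F, k ≠ e → (ω k).1 < τ}.indicator 1 ω *
        (((ω e).1 : ℝ≥0∞) - τ)) ≤ (xUtil T : ℝ≥0∞) := by
  -- The excess of `e` over `τ` is counted only when every other element fails the threshold. Then
  -- at most `e` is acceptable, so the agent's preferences cannot hurt.
  by_cases hA : ∃ e ∈ F, τ ≤ (ω e).1
  · obtain ⟨e₀, he₀, hτ₀⟩ := hA
    have hmem : {(e₀, ω e₀)} ∈ acceptable (I.thresholdPolicy F τ) (outcomes ω F) :=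
      mem_acceptable_thresholdPolicy.2 ⟨e₀, he₀, he₀, hω e₀, hτ₀, rfl⟩
    rcases hT with ⟨hT, -⟩ | ⟨hempty, -⟩
    swap
    · simp [hempty] at hmem
    obtain ⟨e, he, -, -, hτ, rfl⟩ := mem_acceptable_thresholdPolicy.1 hT
    have hx : xUtil {(e, ω e)} = (ω e).1 := by simp [xUtil]
    rw [hx, Set.indicator_of_mem (show ω ∈ {ω : State E | ∃ e ∈ F, τ ≤ (ω e).1} from
      ⟨e, he, hτ⟩), Finset.sum_eq_single e]
    · calc _ ≤ (τ : ℝ≥0∞) + (((ω e).1 : ℝ≥0∞) - τ) := by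
            rw [Pi.one_apply, one_mul]
            gcongr
            refine mul_le_of_le_one_left zero_le ?_
            exact Set.indicator_le_self' (fun _ _ => zero_le) _
        _ = _ := add_tsub_cancel_of_le (by exact_mod_cast hτ)
    · intro k hk hke
      rw [Set.indicator_of_notMem, zero_mul]
      exact fun h => absurd (h e he hke.symm) (not_lt.2 hτ)
    · exact fun h => absurd he h
  · rw [Set.indicator_of_notMem (by exact hA), zero_mul, zero_add, Finset.sum_eq_zero]
    · exact zero_le
    · intro e he
      push Not at hA
      rw [tsub_eq_zero_of_le (by exact_mod_cast (hA e he).le), mul_zero]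

theorem Instance.ae_mem_support (I : Instance E) : ∀ᵐ ω ∂I.law, ∀ e, ω e ∈ (I.μ e).support := by
  have := I.isProb
  rw [ae_all_iff]
  intro e
  exact (Measure.quasiMeasurePreserving_eval I.μ e).ae Measure.support_mem_ae

theorem measurableSet_others_lt (F : Finset E) (τ : ℝ≥0) (e : E) :
    MeasurableSet {ω : State E | ∀ k ∈ F, k ≠ e → (ω k).1 < τ} := by
  have : {ω : State E | ∀ k ∈ F, k ≠ e → (ω k).1 < τ} =
      ⋂ k ∈ F.erase e, {ω : State E | (ω k).1 < τ} := by
    ext ω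
    simp only [Set.mem_ofPred_eq, Set.mem_iInter, Finset.mem_erase]
    exact ⟨fun h k hk => h k hk.2 hk.1, fun h k hk hke => h k ⟨hke, hk⟩⟩
  rw [this]
  exact Finset.measurableSet_biInter _ fun k _ =>
    measurableSet_lt (measurable_pi_apply k).fst measurable_const

theorem measurableSet_exists_le (F : Finset E) (τ : ℝ≥0) :
    MeasurableSet {ω : State E | ∃ e ∈ F, τ ≤ (ω e).1} := by
  have : {ω : State E | ∃ e ∈ F, τ ≤ (ω e).1} = ⋃ e ∈ F, {ω : State E | τ ≤ (ω e).1} := by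
    ext ω; simp
  rw [this]
  exact Finset.measurableSet_biUnion _ fun k _ =>
    measurableSet_le measurable_const (measurable_pi_apply k).fst

theorem measurable_coord (e : E) : Measurable fun ω : State E => ((ω e).1 : ℝ≥0∞) :=
  (measurable_pi_apply e).fst.coe_nnreal_ennreal

/-- A lower bound on the principal's expected utility under a threshold policy. -/
theorem Instance.le_lintegral_xUtil_thresholdPolicy {prop : State E → Finset (Outcome E)}
    (hprop : ∀ ω, IsFavorite (I.thresholdPolicy F τ) (outcomes ω F) (prop ω)) :
    I.law {ω : State E | ∃ e ∈ F, τ ≤ (ω e).1} * τ +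
      ∑ e ∈ F, I.law {ω : State E | ∀ k ∈ F, k ≠ e → (ω k).1 < τ} *
        ∫⁻ ω, (((ω e).1 : ℝ≥0∞) - τ) ∂I.law ≤ ∫⁻ ω, (xUtil (prop ω) : ℝ≥0∞) ∂I.law := by
  -- The lower bound is measurable even if `prop` is not, and it need only hold almost surely, where
  -- all utilities lie in the supports.
  refine le_trans (le_of_eq ?_) (lintegral_mono_ae
    (I.ae_mem_support.mono fun ω hω => thresholdPolicy_le_xUtil hω (hprop ω)))
  have hm := measurableSet_exists_le F τ
  rw [lintegral_add_left ((measurable_one.indicator hm).mul_const _),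
    lintegral_mul_const _ (measurable_one.indicator hm), lintegral_indicator_one hm,
    lintegral_finsetSum]
  · congr 1
    refine Finset.sum_congr rfl fun e _ => ?_
    refine (I.lintegral_indicator_mul (measurableSet_others_lt F τ e) (fun ω v => ?_)
      (f := fun v => (v.1 : ℝ≥0∞) - τ)
      (measurable_fst.coe_nnreal_ennreal.sub measurable_const)).symm
    refine forall_congr' fun k => forall_congr' fun _ => forall_congr' fun hk => ?_
    rw [Function.update_of_ne hk]
  · exact fun e _ => (measurable_one.indicator (measurableSet_others_lt F τ e)).mul
      ((measurable_coord e).sub measurable_const)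

theorem maxUtil_le_add_sum (ω : State E) (F : Finset E) (τ : ℝ≥0) :
    (maxUtil ω F : ℝ≥0∞) ≤ τ + ∑ e ∈ F, (((ω e).1 : ℝ≥0∞) - τ) := by
  have : maxUtil ω F ≤ τ + ∑ e ∈ F, ((ω e).1 - τ) := Finset.sup_le fun e he => by
    have h := Finset.single_le_sum (f := fun e => (ω e).1 - τ) (fun _ _ => zero_le) he
    exact le_add_tsub.trans (add_le_add_right h τ)
  exact_mod_cast this

theorem Instance.lintegral_maxUtil_le (I : Instance E) (F : Finset E) (τ : ℝ≥0) :
    ∫⁻ ω, (maxUtil ω F : ℝ≥0∞) ∂I.law ≤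
      τ + ∑ e ∈ F, ∫⁻ ω, (((ω e).1 : ℝ≥0∞) - τ) ∂I.law := by
  refine (lintegral_mono fun ω => maxUtil_le_add_sum ω F τ).trans ?_
  rw [lintegral_add_left measurable_const, lintegral_const, measure_univ, mul_one,
    lintegral_finsetSum]
  exact fun e _ => (measurable_coord e).sub measurable_const

/-- The prophet inequality against an almighty adversary, for the threshold equal to half of the
expected maximum. -/
theorem Instance.half_le_lintegral_xUtil (hτ : ∫⁻ ω, (maxUtil ω F : ℝ≥0∞) ∂I.law = τ + τ)
    {prop : State E → Finset (Outcome E)}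
    (hprop : ∀ ω, IsFavorite (I.thresholdPolicy F τ) (outcomes ω F) (prop ω)) :
    (τ : ℝ≥0∞) ≤ ∫⁻ ω, (xUtil (prop ω) : ℝ≥0∞) ∂I.law := by
  refine le_trans ?_ (I.le_lintegral_xUtil_thresholdPolicy hprop)
  set A := {ω : State E | ∃ e ∈ F, τ ≤ (ω e).1} with hA
  -- From `2τ ≤ τ + ∑ E(X_e - τ)⁺`, cancelling the finite `τ`.
  have hsum : (τ : ℝ≥0∞) ≤ ∑ e ∈ F, ∫⁻ ω, (((ω e).1 : ℝ≥0∞) - τ) ∂I.law := by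
    have := I.lintegral_maxUtil_le F τ
    rw [hτ] at this
    exact (ENNReal.add_le_add_iff_left ENNReal.coe_ne_top).1 this
  calc (τ : ℝ≥0∞) = I.law A * τ + I.law Aᶜ * τ := by
        rw [← add_mul, measure_add_measure_compl (measurableSet_exists_le F τ), measure_univ,
          one_mul]
    _ ≤ I.law A * τ + I.law Aᶜ * ∑ e ∈ F, ∫⁻ ω, (((ω e).1 : ℝ≥0∞) - τ) ∂I.law := by gcongr
    _ ≤ _ := by
        rw [Finset.mul_sum]
        gcongr with e he
        -- If nothing in `F` reaches `τ`, then in particular nothing other than `e` does.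
        intro ω hω k hk _
        by_contra hlt
        exact hω ⟨k, hk, not_lt.1 hlt⟩

/-- With one element and threshold `0` there are no competitors and the excess is the whole utility.
This serves the case of infinite expectation. -/
theorem Instance.lintegral_coord_le_xUtil {e : E} {prop : State E → Finset (Outcome E)}
    (hprop : ∀ ω, IsFavorite (I.thresholdPolicy {e} 0) (outcomes ω {e}) (prop ω)) :
    ∫⁻ ω, ((ω e).1 : ℝ≥0∞) ∂I.law ≤ ∫⁻ ω, (xUtil (prop ω) : ℝ≥0∞) ∂I.law := by
  refine le_trans ?_ (I.le_lintegral_xUtil_thresholdPolicy hprop)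
  have : {ω : State E | ∀ k ∈ ({e} : Finset E), k ≠ e → (ω k).1 < 0} = Set.univ := by
    ext ω; simp +contextual
  rw [Finset.sum_singleton, this]
  simp

/-- Delegation over a fixed feasible set loses at most a factor `2`. -/
theorem Instance.exists_thresholdPolicy_half {B : Finset E} (hB : B ∈ I.outer.feasible) :
    ∃ (F : Finset E) (_ : F ∈ I.outer.feasible) (τ : ℝ≥0),
      ∀ prop : State E → Finset (Outcome E),
        (∀ ω, IsFavorite (I.thresholdPolicy F τ) (outcomes ω F) (prop ω)) →
          2⁻¹ * ∫⁻ ω, (maxUtil ω B : ℝ≥0∞) ∂I.law ≤ ∫⁻ ω, (xUtil (prop ω) : ℝ≥0∞) ∂I.law := by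
  by_cases htop : ∫⁻ ω, (maxUtil ω B : ℝ≥0∞) ∂I.law = ∞
  -- No finite threshold is half of an infinite expectation, but the maximum is at most the sum, so
  -- some single element already has infinite mean.
  · obtain ⟨e, he, htop_e⟩ : ∃ e ∈ B, ∫⁻ ω, ((ω e).1 : ℝ≥0∞) ∂I.law = ∞ := by
      have := I.lintegral_maxUtil_le B 0
      rw [htop, top_le_iff] at this
      simpa using this
    refine ⟨{e}, I.outer.down_closed (Finset.singleton_subset_iff.2 he) hB, 0,
      fun prop hprop => ?_⟩
    have := I.lintegral_coord_le_xUtil hprop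
    rw [htop_e, top_le_iff] at this
    rw [this]
    exact le_top
  · refine ⟨B, hB, (2⁻¹ * ∫⁻ ω, (maxUtil ω B : ℝ≥0∞) ∂I.law).toNNReal, fun prop hprop => ?_⟩
    have hne : 2⁻¹ * ∫⁻ ω, (maxUtil ω B : ℝ≥0∞) ∂I.law ≠ ∞ :=
      ENNReal.mul_ne_top (by simp) htop
    refine (ENNReal.coe_toNNReal hne).ge.trans (I.half_le_lintegral_xUtil ?_ hprop)
    rw [ENNReal.coe_toNNReal hne, ← add_mul, ENNReal.inv_two_add_inv_two, one_mul]

end ThresholdPolicy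

end DelegatedProbing

end

/-! ### Combining the two factors -/

theorem mainTheorem6 {E : Type*} [Fintype E] [DecidableEq E]
    (I : DelegatedProbing.Instance E)
    (houter : I.outer.IsMatroid) (hinner : I.inner.IsUniform 1) :
    ∃ R : Set (Finset (DelegatedProbing.Outcome E)),
      I.IsAlphaPolicy (1 / 2 * (1 - 1 / Real.exp 1)) R := by
  open DelegatedProbing in
  obtain ⟨M, -, hM⟩ := houter
  -- The supremum defining the non-delegated value need not be known to be attained, so the set is
  -- fixed independently of any strategy: the best of the finitely many feasible ones.
  obtain ⟨B, hB, hmax⟩ : ∃ B ∈ I.outer.feasible, ∀ C ∈ I.outer.feasible,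
      ∫⁻ ω, (maxUtil ω C : ℝ≥0∞) ∂I.law ≤ ∫⁻ ω, (maxUtil ω B : ℝ≥0∞) ∂I.law :=
    Set.exists_max_image I.outer.feasible _ (Set.toFinite _) ⟨∅, I.outer.empty_mem⟩
  obtain ⟨F, hF, τ, hFτ⟩ := I.exists_thresholdPolicy_half hB
  refine ⟨I.thresholdPolicy F τ, I.isPolicy_thresholdPolicy hinner, I.probeAll hF,
    I.isAgentOptimal_probeAll hF, fun prop hprop => ?_⟩
  simp only [I.probed_probeAll hF] at hprop
  refine le_trans ?_ (hFτ prop hprop)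
  rw [ENNReal.ofReal_mul (by norm_num), mul_assoc, one_div, ENNReal.ofReal_inv_of_pos two_pos,
    ENNReal.ofReal_ofNat]
  gcongr
  rw [Instance.nonDelegatedValue, ENNReal.mul_iSup]
  refine iSup_le fun σ => ?_
  obtain ⟨C, hC, hle⟩ := σ.exists_isBase_adaptivity_gap hinner hM
  exact hle.trans (hmax C ((hM C).2 hC.indep))
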